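/- **Setting.** A parity game $\mathcal{G}$ is a finite directed graph $(V,E)$ in which every vertex has an outgoing edge, with a partition $V = V_{\mathrm{Even}} \sqcup V_{\mathrm{Odd}}$ into Steven's and Audrey's vertices and a priority $\pi(v)\in\{0,1,\dots,d\}$ for each vertex, where $d$ is even. For $R\subseteq V$, $\mathcal{G}\cap R$ is the induced substructure; it is a *subgame* if each vertex of $R$ has an outgoing edge inside $R$. A (positional) *Steven strategy* in a subgame is a set $\sigma$ of its edges that contains at least one outgoing edge of each Steven vertex and all outgoing edges of each Audrey vertex. It *traps Audrey in* $S$ if all $\sigma$-edges from $S$ end in $S$; then $S$ is a *trap for Audrey*. A set $D$ is a *Steven dominion* if some Steven strategy $\sigma$ in $\mathcal{G}$ traps Audrey in $D$ and on every cycle of $(D,\sigma)$ the highest priority is even; $W$ denotes the largest Steven dominion (the union of all Steven dominions). The *Steven attractor* to $B$ is the largest set $A\supseteq B$ such that for some Steven strategy $\sigma$ every infinite $\sigma$-path from $A$ visits $B$. **Attractor decompositions.** If all priorities in $\mathcal{G}$ are at most the even number $d$, then $\mathcal{H}=\langle A,(S_1,\mathcal{H}_1,A_1),\dots,(S_\ell,\mathcal{H}_\ell,A_\ell)\rangle$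 is a *Steven $d$-attractor decomposition* of $\mathcal{G}$ if $A$ is the Steven attractor in $\mathcal{G}$ to the set of vertices of priority $d$ and, with $\mathcal{G}_1=\mathcal{G}\setminus A$, for each $i=1,\dots,\ell$: $S_i$ is a non-empty trap for Audrey in $\mathcal{G}_i$ with all priorities at most $d-2$, $\mathcal{H}_i$ is a Steven $(d-2)$-attractor decomposition of $\mathcal{G}\cap S_i$, $A_i$ is the Steven attractor to $S_i$ in $\mathcal{G}_i$, and $\mathcal{G}_{i+1}=\mathcal{G}_i\setminus A_i$; moreover $\mathcal{G}_{\ell+1}$ is empty, and $\ell=0$ if $d=0$. Its tree is the ordered tree $T_{\mathcal{H}}=\langle T_{\mathcal{H}_1},\dots,T_{\mathcal{H}_\ell}\rangle$ (the trivial tree if $\ell=0$). **Progress measures.** For a well-founded linear order $(A,\le)$, the $p$-truncation of $m=\langle m_{d-1},m_{d-3},\dots,m_1\rangle\in A^{d/2}$ consists of the entries with index at least $p$. A *Steven progress measure* is a map $\mu:V\to A^{d/2}$, for some such $A$, for which each Steven vertex has at least one progressive outgoing edge and all edges from Audrey vertices are progressive. Here $(v,u)$ is *progressive* if $\mu(v)|_{\pi(v)}\ge_{\mathrm{lex}}\mu(u)|_{\pi(v)}$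 when $\pi(v)$ is even, and $\mu(v)|_{\pi(v)}>_{\mathrm{lex}}\mu(u)|_{\pi(v)}$ when $\pi(v)$ is odd. Its tree $T_\mu$ is the ordered tree generated by the image of $\mu$ (the tree of all prefixes of values of $\mu$, with siblings ordered by $\le$). **Strahler numbers.** The *Strahler number* of an ordered tree is $1$ for the trivial tree; for $\langle T_1,\dots,T_\ell\rangle$ it is $m=\max_i\mathrm{Str}(T_i)$ if the maximum is attained by exactly one $i$, and $m+1$ otherwise. A tree $\langle T_1,\dots,T_k\rangle$ *can be embedded in* $\langle T'_1,\dots,T'_\ell\rangle$ if there are $i_1<\dots<i_k$ such that each $T_j$ can be embedded in $T'_{i_j}$. The *Steven Strahler number* of $\mathcal{G}$ is the smallest Strahler number of $T_{\mathcal{H}}$ over Steven $d$-attractor decompositions $\mathcal{H}$ of $\mathcal{G}\cap W$. The *Steven progress-measure Strahler number* of $\mathcal{G}$ is the smallest Strahler number of $T_\mu$ over Steven progress measures $\mu$ on $\mathcal{G}\cap W$ (that is, on $\mathcal{G}$ itself if $W=V$). **Theorem.** Let $\mathcal{G}$ be a parity game in which all priorities are at most the even number $d$. 1. Steven $d$-attractor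 decompositions of, and Steven progress measures on, $\mathcal{G}\cap W$ exist, and the Steven Strahler number and the Steven progress-measure Strahler number of $\mathcal{G}$ differ by at most $1$. 2. For every subgame $\mathcal{G}\cap R$ of $\mathcal{G}$ (in particular for $\mathcal{G}$ itself): - for every Steven $d$-attractor decomposition $\mathcal{H}$ of $\mathcal{G}\cap R$ there is a Steven progress measure $\mu$ on $\mathcal{G}\cap R$, with values in $\mathbb{N}^{d/2}$, such that $\mathrm{Str}(T_\mu)\le\mathrm{Str}(T_{\mathcal{H}})+1$; - for every Steven progress measure $\mu$ on $\mathcal{G}\cap R$ there is a Steven $d$-attractor decomposition $\mathcal{H}$ of $\mathcal{G}\cap R$ such that $T_{\mathcal{H}}$ can be embedded in $T_\mu$; in particular $\mathrm{Str}(T_{\mathcal{H}})\le\mathrm{Str}(T_\mu)$. -/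

import Mathlib

universe u w

/-! ### Parity games -/

/-- A parity game with vertex set `V`: a directed graph in which every vertex has an outgoing edge,
a set `steven` of vertices owned by Steven (player Even; the other vertices are owned by Audrey,
player Odd), and a priority for every vertex.  Finiteness of `V` is assumed where it is used. -/
structure ParityGame (V : Type u) where
  edge : V → V → Prop
  steven : Set V
  priority : V → ℕ
  total : ∀ v, ∃ u, edge v u

namespace ParityGame

variable {V : Type u} (G : ParityGame V)

/-! For a set `R` of vertices, `G ∩ R` is the substructure induced by `R`.  All notions below are
relative to such a substructure; the whole game is the case `R = Set.univ`. -/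

/-- `G ∩ R` is a subgame: every vertex of `R` has an outgoing edge that stays in `R`. -/
def IsSubgame (R : Set V) : Prop :=
  ∀ v ∈ R, ∃ u ∈ R, G.edge v u

/-- `σ` (a set of edges) is a positional Steven strategy in `G ∩ R`. -/
structure IsStevenStrategy (R : Set V) (σ : V → V → Prop) : Prop where
  sub : ∀ v u, σ v u → v ∈ R ∧ u ∈ R ∧ G.edge v u
  steven_move : ∀ v ∈ R, v ∈ G.steven → ∃ u, σ v u
  audrey_move : ∀ v ∈ R, v ∉ G.steven → ∀ u ∈ R, G.edge v u → σ v u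

/-- The strategy `σ` traps Audrey in `S`. -/
def TrapsAudrey (σ : V → V → Prop) (S : Set V) : Prop :=
  ∀ v ∈ S, ∀ u, σ v u → u ∈ S

/-- `S` is a trap for Audrey in `G ∩ R`. -/
def IsTrapForAudrey (R S : Set V) : Prop :=
  S ⊆ R ∧ ∃ σ, G.IsStevenStrategy R σ ∧ TrapsAudrey σ S

/-- Every cycle of the subgraph `(D, σ)` is even: the highest priority on it is even.  The cycle is
`c 0, c 1, …, c (n - 1), c n = c 0`. -/
def CyclesEven (σ : V → V → Prop) (D : Set V) : Prop :=
  ∀ (n : ℕ) (c : ℕ → V), 0 < n → c n = c 0 → (∀ i ≤ n, c i ∈ D) →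
    (∀ i < n, σ (c i) (c (i + 1))) →
    Even ((Finset.range n).sup fun i => G.priority (c i))

/-- `D` is a Steven dominion in `G`. -/
def IsStevenDominion (D : Set V) : Prop :=
  ∃ σ, G.IsStevenStrategy Set.univ σ ∧ TrapsAudrey σ D ∧ G.CyclesEven σ D

/-- The largest Steven dominion in `G`: the union of all Steven dominions. -/
def largestStevenDominion : Set V :=
  ⋃₀ {D | G.IsStevenDominion D}

/-! ### Attractor decompositions -/

/-- `σ` is a Steven reachability strategy to `B` from `A` in `G ∩ R`. -/
def IsStevenReachabilityStrategy (R B A : Set V) (σ : V → V → Prop) : Prop :=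
  G.IsStevenStrategy R σ ∧
    ∀ p : ℕ → V, p 0 ∈ A → (∀ i, σ (p i) (p (i + 1))) → ∃ i, p i ∈ B

/-- `A` is the Steven attractor to `B` in `G ∩ R`: the largest set from which Steven has a
reachability strategy to `B`. -/
def IsStevenAttractor (R B A : Set V) : Prop :=
  IsGreatest {A | B ⊆ A ∧ A ⊆ R ∧ ∃ σ, G.IsStevenReachabilityStrategy R B A σ} A

end ParityGame

/-- Ordered trees; `node []` is the trivial tree. -/
inductive OrderedTree : Type
  | node (children : List OrderedTree) : OrderedTree

/-- The raw data `⟨A, (S₁, H₁, A₁), …, (S_ℓ, H_ℓ, A_ℓ)⟩` of an attractor decomposition of level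
`d = 2 * h`; every `H_i` has level `d - 2`, and `ℓ = 0` if `d = 0`. -/
def DecompositionData (V : Type u) : ℕ → Type u
  | 0 => Set V
  | h + 1 => Set V × List (Set V × DecompositionData V h × Set V)

/-- The tree of a decomposition. -/
def DecompositionData.tree {V : Type u} : (h : ℕ) → DecompositionData V h → OrderedTree
  | 0, _ => .node []
  | h + 1, H => .node (H.2.map fun p => DecompositionData.tree h p.2.1)

namespace ParityGame

variable {V : Type u} (G : ParityGame V)

/-- The conditions on the triples `(S_i, H_i, A_i)` of a `2 * (h + 1)`-attractor decomposition.
The set `R` is the vertex set of the current game `G_i`, which starts as `G₁`; the predicate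
`P S H` says that `H` is a `2 * h`-attractor decomposition of `G ∩ S`. -/
def IsLayering {α : Type u} (h : ℕ) (P : Set V → α → Prop) :
    Set V → List (Set V × α × Set V) → Prop
  | R, [] => R = ∅
  | R, (S, H, A) :: rest =>
      S.Nonempty ∧ G.IsTrapForAudrey R S ∧ (∀ v ∈ S, G.priority v ≤ 2 * h) ∧ P S H ∧
        G.IsStevenAttractor R S A ∧ IsLayering h P (R \ A) rest

/-- `H` is a Steven `2 * h`-attractor decomposition of `G ∩ R` (where all priorities in `R` are at
most `2 * h`). -/
def IsStevenDecomposition : (h : ℕ) → (R : Set V) → DecompositionData V h → Prop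
  | 0, R, (A : Set V) =>
      G.IsStevenAttractor R {v ∈ R | G.priority v = 0} A ∧ R \ A = ∅
  | h + 1, R, H =>
      G.IsStevenAttractor R {v ∈ R | G.priority v = 2 * (h + 1)} H.1 ∧
        G.IsLayering h (IsStevenDecomposition h) (R \ H.1) H.2

end ParityGame

/-! ### Strahler numbers and embeddings of ordered trees -/

/-- The Strahler number of a tree from the list of the Strahler numbers of the subtrees rooted in
the children of its root. -/
def strahlerOfChildren (l : List ℕ) : ℕ :=
  if l = [] then 1
  else if l.count (l.foldr max 0) = 1 then l.foldr max 0
  else l.foldr max 0 + 1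

/-- The Strahler number of an ordered tree. -/
def OrderedTree.strahler : OrderedTree → ℕ
  | .node ts => strahlerOfChildren (ts.map OrderedTree.strahler)

/-- `T.Embeds T'`: the ordered tree `T` can be embedded in the ordered tree `T'`. -/
inductive OrderedTree.Embeds : OrderedTree → OrderedTree → Prop
  | node (ts us : List OrderedTree) (f : Fin ts.length → Fin us.length) (hf : StrictMono f)
      (h : ∀ j, OrderedTree.Embeds (ts.get j) (us.get (f j))) :
      OrderedTree.Embeds (.node ts) (.node us)

/-! ### Progress measures -/

/-- The `p`-truncation of `m = ⟨m_{d-1}, m_{d-3}, …, m_1⟩`, where `d = 2 * h` and the entry with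
index `d - 1 - 2 * i` is `m i`: the sequence of the entries with index at least `p`, which are the
first `h - ⌊p / 2⌋` entries. -/
def truncation {A : Type w} {h : ℕ} (m : Fin h → A) (p : ℕ) : List A :=
  (List.ofFn m).take (h - p / 2)

/-- The ordered tree generated by a finite set of sequences of length `h`: the children of the root
correspond, in increasing order, to the distinct first entries `a`, and the subtree rooted in the
child for `a` is generated by the sequences that follow `a`. -/
def generatedTree {A : Type w} [LinearOrder A] : (h : ℕ) → Finset (Fin h → A) → OrderedTree
  | 0, _ => .node []
  | h + 1, X =>
      .node (((X.image fun m => m 0).sort (· ≤ ·)).map fun a =>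
        generatedTree h ((X.filter fun m => m 0 = a).image Fin.tail))

namespace ParityGame

variable {V : Type u} (G : ParityGame V)

/-- The edge `(v, u)` is `μ`-progressive.  Sequences are compared lexicographically. -/
def Progressive {A : Type w} [LinearOrder A] {h : ℕ} (μ : V → Fin h → A) (v u : V) : Prop :=
  (Even (G.priority v) → truncation (μ u) (G.priority v) ≤ truncation (μ v) (G.priority v)) ∧
  (Odd (G.priority v) → truncation (μ u) (G.priority v) < truncation (μ v) (G.priority v))

/-- `μ` is a Steven progress measure on `G ∩ R`, with `d = 2 * h`.  Only the values of `μ` on `R`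
matter. -/
def IsStevenProgressMeasure {A : Type w} [LinearOrder A] {h : ℕ} (R : Set V)
    (μ : V → Fin h → A) : Prop :=
  ∀ v ∈ R,
    (v ∈ G.steven → ∃ u ∈ R, G.edge v u ∧ G.Progressive μ v u) ∧
    (v ∉ G.steven → ∀ u ∈ R, G.edge v u → G.Progressive μ v u)

/-- The tree of a progress measure `μ` on `G ∩ R`. -/
noncomputable def measureTree {A : Type w} [LinearOrder A] [Finite V] {h : ℕ} (R : Set V)
    (μ : V → Fin h → A) : OrderedTree :=
  generatedTree h (Set.toFinite (μ '' R)).toFinset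

/-! ### Strahler numbers of parity games -/

/-- The Strahler numbers of the Steven `2 * h`-attractor decompositions of `G ∩ R`. -/
def decompositionStrahlerNumbers (h : ℕ) (R : Set V) : Set ℕ :=
  {k | ∃ H : DecompositionData V h, G.IsStevenDecomposition h R H ∧ (H.tree h).strahler = k}

/-- The Strahler numbers of the trees of Steven progress measures on `G ∩ R`, with `d = 2 * h`. -/
def measureStrahlerNumbers [Finite V] (h : ℕ) (R : Set V) : Set ℕ :=
  {k | ∃ (A : Type) (_ : LinearOrder A) (_ : WellFoundedLT A) (μ : V → Fin h → A),
    G.IsStevenProgressMeasure R μ ∧ (measureTree R μ).strahler = k}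

/-- The Steven Strahler number of `G`: the smallest Strahler number of a Steven attractor
decomposition of the largest Steven dominion. -/
noncomputable def stevenStrahlerNumber (h : ℕ) : ℕ :=
  sInf (G.decompositionStrahlerNumbers h G.largestStevenDominion)

/-- The Steven progress-measure Strahler number of `G`: the smallest Strahler number of the tree of
a Steven progress measure on the largest Steven dominion (the whole of `G` if Steven wins from
every vertex). -/
noncomputable def stevenMeasureStrahlerNumber [Finite V] (h : ℕ) : ℕ :=
  sInf (G.measureStrahlerNumbers h G.largestStevenDominion)

end ParityGame

/-! ### Strahler numbers -/

/-! Both translations are recursions on `d`, and both work with the first entry ("head") of a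
measure's values.

From a decomposition to a measure: a set `S` gets head 0, the rest of its attractor gets its
distance to `S` as head with a zero tail, and the remaining game is shifted above all these heads
(`exists_measure_of_attr`). This is applied first to the vertices of top priority and then to each
`S_i`. Compared with `T_H`, the tree of the measure has extra children at every level, but each of
them is a path, of Strahler number 1. Bounding a Strahler number by `k` means counting children at
the thresholds `k` and `k + 1` (`strahlerOfChildren_le_iff`); from threshold 2 on the paths are
invisible. So the extra children cost 1 in total, not 1 per level: a child of the new tree with
number at least `k + 1` comes from a child of `T_H` with number at least `k`.

From a measure to a decomposition: below the top priority, progressive edges never raise the head,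
so the vertices with the smallest head form a trap for Audrey. It becomes the next `S_i`, its
attractor is removed, and the argument repeats (`exists_isLayering_of_measure`). Each `S_i` uses its
own head, in increasing order, hence the embedding, and embeddings do not increase Strahler numbers.

Existence on `W`: the union of all dominions is a dominion, and a strategy with only even cycles
yields a decomposition, because some non-empty set closed under it avoids a maximal odd priority
(`exists_closed_of_cyclesEven`). -/

theorem le_foldr_max {l : List ℕ} {x : ℕ} (hx : x ∈ l) : x ≤ l.foldr max 0 := by
  induction l with
  | nil => simp at hx
  | cons a l ih =>
    rcases List.mem_cons.1 hx with rfl | hx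
    · simp
    · simpa using Or.inr (ih hx)

theorem foldr_max_mem {l : List ℕ} (hl : l ≠ []) : l.foldr max 0 ∈ l := by
  induction l with
  | nil => exact absurd rfl hl
  | cons a l ih =>
    by_cases h : l = []
    · subst h; simp
    · rcases le_total a (l.foldr max 0) with h' | h'
      · simp [max_eq_right h', ih h]
      · simp [max_eq_left h']

/-- Rephrasing by threshold counts replaces the case split on the maximum by quantities that are
additive along a list and monotone under injections. -/
theorem strahlerOfChildren_le_iff {l : List ℕ} {k : ℕ} (hk : 1 ≤ k) :
    strahlerOfChildren l ≤ k ↔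
      l.countP (fun x => k ≤ x) ≤ 1 ∧ l.countP (fun x => k + 1 ≤ x) = 0 := by
  unfold strahlerOfChildren
  by_cases hl : l = []
  · simp [hl, hk]
  rw [if_neg hl]
  have hmem := foldr_max_mem hl
  have hle : ∀ x ∈ l, x ≤ l.foldr max 0 := fun x hx => le_foldr_max hx
  generalize l.foldr max 0 = M at *
  have hzero : ∀ j, M < j → l.countP (fun x => j ≤ x) = 0 := fun j hj => by
    rw [List.countP_eq_zero]
    intro x hx
    have := hle x hx
    simp only [decide_eq_true_eq]
    omega
  have hcount : l.countP (fun x => M ≤ x) = l.count M := by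
    rw [List.count]
    refine List.countP_congr fun x hx => ?_
    have := hle x hx
    simp only [decide_eq_true_eq, beq_iff_eq]
    omega
  have hpos : 0 < l.count M := List.count_pos_iff.2 hmem
  rcases lt_trichotomy M k with h | h | h
  · refine iff_of_true (by split_ifs <;> omega) ⟨?_, hzero _ (by omega)⟩
    rw [hzero _ h]; omega
  · subst h
    rw [hcount, hzero _ (Nat.lt_succ_self _)]
    split_ifs <;> omega
  · refine iff_of_false (by split_ifs <;> omega) fun ⟨_, h'⟩ => ?_
    rw [List.countP_eq_zero] at h'
    exact h' M hmem (by simpa using h)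

namespace OrderedTree

theorem strahler_node (ts : List OrderedTree) :
    (node ts).strahler = strahlerOfChildren (ts.map strahler) := by
  rw [strahler]

theorem strahler_node_le_iff {ts : List OrderedTree} {k : ℕ} (hk : 1 ≤ k) :
    (node ts).strahler ≤ k ↔
      ts.countP (fun t => k ≤ t.strahler) ≤ 1 ∧
        ts.countP (fun t => k + 1 ≤ t.strahler) = 0 := by
  rw [strahler_node, strahlerOfChildren_le_iff hk, List.countP_map, List.countP_map]
  rfl

theorem one_le_strahler : ∀ T : OrderedTree, 1 ≤ T.strahler
  | node ts => by
    have ih : ∀ t ∈ ts, 1 ≤ t.strahler := fun t _ => one_le_strahler t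
    rw [strahler_node, strahlerOfChildren]
    split_ifs with h
    · exact le_rfl
    · have := foldr_max_mem h
      obtain ⟨t, ht, ht'⟩ := List.mem_map.1 this
      rw [← ht']
      exact ih t ht
    · omega

theorem strahler_nil : (node []).strahler = 1 := by
  simp [strahler_node, strahlerOfChildren]

theorem strahler_singleton (t : OrderedTree) : (node [t]).strahler = t.strahler := by
  simp [strahler_node, strahlerOfChildren]

/-- The injection on children maps a child above a threshold to one above it, so both threshold
counts can only grow. -/
theorem Embeds.strahler_le {T T' : OrderedTree} (h : T.Embeds T') :
    T.strahler ≤ T'.strahler := by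
  induction h with
  | node ts us f hf _ ih =>
    obtain ⟨h₁, h₂⟩ := (strahler_node_le_iff (one_le_strahler (.node us))).1 le_rfl
    refine (strahler_node_le_iff (one_le_strahler _)).2 ?_
    have key : ∀ k, ts.countP (fun t => k ≤ t.strahler) ≤ us.countP (fun t => k ≤ t.strahler) := by
      intro k
      have hcard : ∀ l : List OrderedTree, l.countP (fun t => k ≤ t.strahler) =
          (Finset.univ.filter fun i : Fin l.length => k ≤ (l.get i).strahler).card := by
        intro l
        conv_lhs => rw [← List.map_get_finRange l]
        rw [List.countP_map, List.countP_eq_length_filter,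
          ← List.toFinset_card_of_nodup ((List.nodup_finRange _).filter _)]
        congr 1
        ext i
        simp
      rw [hcard, hcard]
      refine Finset.card_le_card_of_injOn f (fun i hi => ?_) hf.injective.injOn
      simp only [Finset.coe_filter, Finset.mem_univ, true_and, Set.mem_ofPred_eq] at hi ⊢
      exact hi.trans (ih i)
    exact ⟨(key _).trans h₁, Nat.le_zero.1 ((key _).trans h₂.le)⟩

theorem embeds_of_sublistForall₂ {ts us : List OrderedTree}
    (h : List.SublistForall₂ Embeds ts us) : (node ts).Embeds (node us) := by
  obtain ⟨l, hl, hs⟩ := List.sublistForall₂_iff.1 h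
  obtain ⟨f, hf⟩ := List.sublist_iff_exists_fin_orderEmbedding_get_eq.1 hs
  refine .node ts us (fun j => f (j.cast hl.length_eq)) (fun i j hij => f.strictMono hij)
    fun j => ?_
  rw [← hf]
  exact hl.get j.2 _

end OrderedTree

/-! ### Trees of sequences -/

theorem truncation_eq_cons {A : Type w} {h : ℕ} (m : Fin (h + 1) → A) {p : ℕ}
    (hp : p ≤ 2 * h + 1) : truncation m p = m 0 :: truncation (Fin.tail m) p := by
  have : h + 1 - p / 2 = (h - p / 2) + 1 := by omega
  rw [truncation, truncation, this, List.ofFn_succ, List.take_succ_cons]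
  rfl

theorem List.cons_le_cons_iff_of_linearOrder {A : Type w} [LinearOrder A] {a b : A}
    {l m : List A} : a :: l ≤ b :: m ↔ a < b ∨ a = b ∧ l ≤ m := by
  rw [← not_lt, ← not_lt (a := m), List.cons_lt_cons_iff, not_or, not_and, not_lt]
  constructor
  · rintro ⟨h₁, h₂⟩
    exact h₁.lt_or_eq.imp_right fun h => ⟨h, h₂ h.symm⟩
  · rintro (h | ⟨rfl, h⟩)
    · exact ⟨h.le, fun e => absurd e h.ne'⟩
    · exact ⟨le_rfl, fun _ => h⟩

theorem truncation_eq_nil {A : Type w} {h : ℕ} (m : Fin h → A) {p : ℕ}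
    (hp : 2 * h ≤ p) : truncation m p = [] := by
  have : h - p / 2 = 0 := by omega
  rw [truncation, this, List.take_zero]

namespace ParityGame

variable {V : Type u} (G : ParityGame V)

/-! ### Progressive edges and the first entry -/

section Progressive

variable {A : Type w} [LinearOrder A] {h : ℕ}

theorem progressive_of_priority_eq {μ : V → Fin h → A} {v : V} (hv : G.priority v = 2 * h)
    (u : V) : G.Progressive μ v u := by
  refine ⟨fun _ => ?_, fun ho => ?_⟩
  · rw [truncation_eq_nil _ hv.ge, truncation_eq_nil _ hv.ge]
  · rw [hv] at ho
    exact absurd ho (by simp)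

variable {G} {μ : V → Fin (h + 1) → A} {v u : V}

theorem progressive_of_head_lt (hv : G.priority v ≤ 2 * h + 1) (hlt : μ u 0 < μ v 0) :
    G.Progressive μ v u := by
  rw [Progressive, truncation_eq_cons _ hv, truncation_eq_cons _ hv]
  have : μ u 0 :: truncation (Fin.tail (μ u)) (G.priority v) <
      μ v 0 :: truncation (Fin.tail (μ v)) (G.priority v) :=
    List.cons_lt_cons_iff.2 (Or.inl hlt)
  exact ⟨fun _ => this.le, fun _ => this⟩

theorem progressive_iff_of_head_eq (hv : G.priority v ≤ 2 * h + 1) (heq : μ u 0 = μ v 0) :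
    G.Progressive μ v u ↔ G.Progressive (fun x => Fin.tail (μ x)) v u := by
  rw [Progressive, Progressive, truncation_eq_cons _ hv, truncation_eq_cons _ hv, heq,
    List.cons_le_cons_iff_of_linearOrder, List.cons_lt_cons_iff]
  simp

theorem Progressive.head_le (hp : G.Progressive μ v u) (hv : G.priority v ≤ 2 * h + 1) :
    μ u 0 ≤ μ v 0 := by
  rw [Progressive, truncation_eq_cons _ hv, truncation_eq_cons _ hv,
    List.cons_le_cons_iff_of_linearOrder, List.cons_lt_cons_iff] at hp
  rcases Nat.even_or_odd (G.priority v) with he | ho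
  · rcases hp.1 he with h | h
    exacts [h.le, h.1.le]
  · rcases hp.2 ho with h | h
    exacts [h.le, h.1.le]

/-- At priority `d - 1` the truncation keeps only the head, so strict progress must take place
there. -/
theorem Progressive.head_lt (hp : G.Progressive μ v u) (hv : G.priority v = 2 * h + 1) :
    μ u 0 < μ v 0 := by
  refine lt_of_le_of_ne (hp.head_le hv.le) fun heq => ?_
  rw [progressive_iff_of_head_eq hv.le heq, Progressive, truncation_eq_nil _ (by omega),
    truncation_eq_nil _ (by omega)] at hp
  exact absurd (hp.2 ⟨h, hv⟩) (lt_irrefl _)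

end Progressive

/-! ### The tree of a measure, split by first entries -/

section MeasureTree

variable {A : Type w} [LinearOrder A] [Finite V]

theorem measureTree_congr {h : ℕ} {R R' : Set V} {μ ν : V → Fin h → A} (hR : R = R')
    (hμ : ∀ v ∈ R', μ v = ν v) : measureTree R μ = measureTree R' ν := by
  subst hR
  rw [measureTree, measureTree]
  congr 2
  exact Set.image_congr hμ

theorem measureTree_succ {h : ℕ} (R : Set V) (μ : V → Fin (h + 1) → A) :
    measureTree R μ = .node ((((Set.toFinite ((fun v => μ v 0) '' R)).toFinset.sort (· ≤ ·))).map
      fun a => measureTree {v ∈ R | μ v 0 = a} fun v => Fin.tail (μ v)) := by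
  classical
  rw [measureTree, generatedTree]
  congr 1
  have e : ((Set.toFinite (μ '' R)).toFinset.image fun m => m 0) =
      (Set.toFinite ((fun v => μ v 0) '' R)).toFinset := by
    ext a; simp
  rw [← e]
  refine List.map_congr_left fun a _ => ?_
  rw [measureTree]
  congr 1
  ext m
  simp only [Finset.mem_image, Finset.mem_filter, Set.Finite.mem_toFinset, Set.mem_image,
    Set.mem_ofPred_eq]
  constructor
  · rintro ⟨_, ⟨⟨v, hv, rfl⟩, ha⟩, rfl⟩
    exact ⟨v, ⟨hv, ha⟩, rfl⟩
  · rintro ⟨v, ⟨hv, ha⟩, rfl⟩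
    exact ⟨_, ⟨⟨v, hv, rfl⟩, ha⟩, rfl⟩

theorem strahler_measureTree_of_subsingleton :
    ∀ {h : ℕ} {R : Set V} {μ : V → Fin h → A}, (∀ v ∈ R, ∀ u ∈ R, μ v = μ u) →
      (measureTree R μ).strahler = 1
  | 0, R, μ, _ => by rw [measureTree, generatedTree, OrderedTree.strahler_nil]
  | h + 1, R, μ, hμ => by
    rw [measureTree_succ]
    rcases R.eq_empty_or_nonempty with rfl | ⟨v, hv⟩
    · simp [OrderedTree.strahler_nil]
    · have : (Set.toFinite ((fun v => μ v 0) '' R)).toFinset = {μ v 0} := by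
        ext a
        simp only [Set.Finite.mem_toFinset, Set.mem_image, Finset.mem_singleton]
        constructor
        · rintro ⟨u, hu, rfl⟩
          rw [hμ u hu v hv]
        · rintro rfl
          exact ⟨v, hv, rfl⟩
      rw [this, Finset.sort_singleton, List.map_singleton, OrderedTree.strahler_singleton]
      exact strahler_measureTree_of_subsingleton fun x hx y hy => by rw [hμ x hx.1 y hy.1]

/-- The first entries of the values of `μ` on `R` for which the subtree of the tree of `μ` has a
Strahler number of at least `k`. -/
def heavyHeads {h : ℕ} (R : Set V) (μ : V → Fin (h + 1) → A) (k : ℕ) : Set A :=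
  {a | k ≤ (measureTree {v ∈ R | μ v 0 = a} fun v => Fin.tail (μ v)).strahler}

/-- An unused head has an empty fibre, whose tree has Strahler number 1; at threshold 1 every
element of `A` would therefore count as heavy. -/
theorem heavyHeads_subset {h : ℕ} {R : Set V} {μ : V → Fin (h + 1) → A} {k : ℕ} (hk : 2 ≤ k) :
    heavyHeads R μ k ⊆ (fun v => μ v 0) '' R := by
  intro a ha
  by_contra hc
  rw [heavyHeads, Set.mem_ofPred_eq, strahler_measureTree_of_subsingleton] at ha
  · omega
  · exact fun v hv => absurd ⟨v, hv.1, hv.2⟩ hc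

theorem finite_heavyHeads {h : ℕ} {R : Set V} {μ : V → Fin (h + 1) → A} {k : ℕ} (hk : 2 ≤ k) :
    (heavyHeads R μ k).Finite :=
  (Set.toFinite _).subset (heavyHeads_subset hk)

theorem strahler_measureTree_le_iff {h : ℕ} {R : Set V} {μ : V → Fin (h + 1) → A} {k : ℕ}
    (hk : 2 ≤ k) : (measureTree R μ).strahler ≤ k ↔
      (heavyHeads R μ k).ncard ≤ 1 ∧ (heavyHeads R μ (k + 1)).ncard = 0 := by
  classical
  have key : ∀ j, 2 ≤ j → ((((Set.toFinite ((fun v => μ v 0) '' R)).toFinset.sort (· ≤ ·))).map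
      fun a => measureTree {v ∈ R | μ v 0 = a} fun v => Fin.tail (μ v)).countP
        (fun t => j ≤ t.strahler) = (heavyHeads R μ j).ncard := by
    intro j hj
    have e : heavyHeads R μ j = ↑((Set.toFinite ((fun v => μ v 0) '' R)).toFinset.filter
        fun a => j ≤ (measureTree {v ∈ R | μ v 0 = a} fun v => Fin.tail (μ v)).strahler) := by
      ext a
      simp only [Finset.coe_filter, Set.Finite.mem_toFinset, Set.mem_ofPred_eq]
      exact ⟨fun ha => ⟨heavyHeads_subset hj ha, ha⟩, fun ha => ha.2⟩
    rw [e, Set.ncard_coe_finset, List.countP_map, List.countP_eq_length_filter,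
      ← List.toFinset_card_of_nodup ((Finset.sort_nodup _ _).filter _)]
    congr 1
    ext a
    simp
  rw [measureTree_succ, OrderedTree.strahler_node_le_iff (by omega), key _ hk,
    key _ (by omega)]

end MeasureTree

end ParityGame
namespace ParityGame

variable {V : Type u} (G : ParityGame V)

/-! ### Attractors -/

/-- The vertices of `G ∩ R` from which Steven can force a visit to `B` within `n` moves. -/
def attrStage (R B : Set V) : ℕ → Set V
  | 0 => B
  | n + 1 => attrStage R B n ∪ {v ∈ R |
      (v ∈ G.steven ∧ ∃ u ∈ R, G.edge v u ∧ u ∈ attrStage R B n) ∨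
      (v ∉ G.steven ∧ ∀ u ∈ R, G.edge v u → u ∈ attrStage R B n)}

/-- The vertices of `G ∩ R` from which Steven can force a visit to `B`. -/
def attr (R B : Set V) : Set V :=
  ⋃ n, G.attrStage R B n

/-- The number of moves within which Steven can force a visit to `B` in `G ∩ R`. -/
noncomputable def attrRank (R B : Set V) (v : V) : ℕ :=
  sInf {n | v ∈ G.attrStage R B n}

variable {G} {R B A : Set V} {v u : V}

theorem attrStage_mono : Monotone (G.attrStage R B) :=
  monotone_nat_of_le_succ fun _ => Set.subset_union_left

theorem mem_attr_of_mem_attrStage {n : ℕ} (hv : v ∈ G.attrStage R B n) : v ∈ G.attr R B :=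
  Set.mem_iUnion.2 ⟨n, hv⟩

theorem subset_attr : B ⊆ G.attr R B :=
  fun _ hv => mem_attr_of_mem_attrStage (n := 0) hv

theorem attr_subset (hB : B ⊆ R) : G.attr R B ⊆ R := by
  refine Set.iUnion_subset fun n => ?_
  induction n with
  | zero => exact hB
  | succ n ih => exact Set.union_subset ih (Set.sep_subset _ _)

theorem mem_attrStage_attrRank (hv : v ∈ G.attr R B) :
    v ∈ G.attrStage R B (G.attrRank R B v) :=
  Nat.sInf_mem (s := {n | v ∈ G.attrStage R B n}) (Set.mem_iUnion.1 hv)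

theorem attrRank_le {n : ℕ} (hv : v ∈ G.attrStage R B n) : G.attrRank R B v ≤ n :=
  Nat.sInf_le hv

theorem attrRank_eq_zero (hv : v ∈ B) : G.attrRank R B v = 0 :=
  Nat.le_zero.1 (attrRank_le (n := 0) hv)

theorem attrRank_pos (hv : v ∈ G.attr R B) (hvB : v ∉ B) : 0 < G.attrRank R B v := by
  by_contra h0
  have := mem_attrStage_attrRank hv
  rw [Nat.eq_zero_of_not_pos h0] at this
  exact hvB this

theorem attr_cases (hv : v ∈ G.attr R B) (hvB : v ∉ B) :
    v ∈ R ∧ ((v ∈ G.steven ∧ ∃ u ∈ R, G.edge v u ∧ u ∈ G.attr R B ∧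
        G.attrRank R B u < G.attrRank R B v) ∨
      (v ∉ G.steven ∧ ∀ u ∈ R, G.edge v u → u ∈ G.attr R B ∧
        G.attrRank R B u < G.attrRank R B v)) := by
  obtain ⟨n, hn⟩ := Nat.exists_eq_succ_of_ne_zero (attrRank_pos hv hvB).ne'
  have hmem := mem_attrStage_attrRank hv
  rw [hn] at hmem ⊢
  have low : ∀ u ∈ G.attrStage R B n, u ∈ G.attr R B ∧ G.attrRank R B u < n.succ :=
    fun u hu => ⟨mem_attr_of_mem_attrStage hu, Nat.lt_succ_of_le (attrRank_le hu)⟩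
  rcases hmem with hmem | ⟨hR, ⟨hs, u, huR, hvu, hu⟩ | ⟨hs, hu⟩⟩
  · have := attrRank_le hmem
    omega
  · exact ⟨hR, Or.inl ⟨hs, u, huR, hvu, low u hu⟩⟩
  · exact ⟨hR, Or.inr ⟨hs, fun u huR hvu => low u (hu u huR hvu)⟩⟩

theorem not_mem_attr_of_edge (hvR : v ∈ R) (hs : v ∈ G.steven) (hv : v ∉ G.attr R B)
    (huR : u ∈ R) (hvu : G.edge v u) : u ∉ G.attr R B := fun hu =>
  hv (mem_attr_of_mem_attrStage (n := G.attrRank R B u + 1)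
    (Or.inr ⟨hvR, Or.inl ⟨hs, u, huR, hvu, mem_attrStage_attrRank hu⟩⟩))

theorem exists_edge_not_mem_attr [Finite V] (hvR : v ∈ R) (hs : v ∉ G.steven)
    (hv : v ∉ G.attr R B) : ∃ u ∈ R, G.edge v u ∧ u ∉ G.attr R B := by
  by_contra! hc
  -- Finiteness bounds all ranks by one `N`; if every move led into the attractor, stage `N + 1`
  -- would contain `v`.
  obtain ⟨N, hN⟩ := (Set.finite_range (G.attrRank R B)).bddAbove
  exact hv (mem_attr_of_mem_attrStage (n := N + 1) (Or.inr ⟨hvR, Or.inr ⟨hs, fun u huR hvu =>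
    attrStage_mono (hN ⟨u, rfl⟩) (mem_attrStage_attrRank (hc u huR hvu))⟩⟩))

/-- Moves that lower the rank must reach `B`; outside `attr` every strategy admits an infinite path
that stays outside. Only Steven needs moves: an Audrey vertex without moves in `R` is in stage 1 and
starts no infinite path. -/
theorem isStevenAttractor_attr [Finite V] (hB : B ⊆ R)
    (hR : ∀ v ∈ R, v ∈ G.steven → ∃ u ∈ R, G.edge v u) :
    G.IsStevenAttractor R B (G.attr R B) := by
  refine ⟨⟨subset_attr, attr_subset hB, fun v u => v ∈ R ∧ u ∈ R ∧ G.edge v u ∧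
    (v ∈ G.attr R B → v ∉ B → u ∈ G.attr R B ∧ G.attrRank R B u < G.attrRank R B v),
    ⟨fun v u h => ⟨h.1, h.2.1, h.2.2.1⟩, fun v hv hs => ?_, fun v hv hs u hu hvu => ?_⟩,
    fun p hp hσ => ?_⟩, ?_⟩
  · by_cases h : v ∈ G.attr R B ∧ v ∉ B
    · obtain ⟨u, hu, hvu, hlow⟩ := (attr_cases h.1 h.2).2.resolve_right (fun h' => h'.1 hs) |>.2
      exact ⟨u, hv, hu, hvu, fun _ _ => hlow⟩
    · obtain ⟨u, hu, hvu⟩ := hR v hv hs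
      exact ⟨u, hv, hu, hvu, fun h₁ h₂ => absurd ⟨h₁, h₂⟩ h⟩
  · refine ⟨hv, hu, hvu, fun h₁ h₂ => ?_⟩
    exact ((attr_cases h₁ h₂).2.resolve_left (fun h' => hs h'.1)).2 u hu hvu
  · by_contra! hc
    have hmem : ∀ i, p i ∈ G.attr R B := fun i => by
      induction i with
      | zero => exact hp
      | succ i ih => exact ((hσ i).2.2.2 ih (hc i)).1
    have hlt : ∀ i, G.attrRank R B (p (i + 1)) < G.attrRank R B (p i) := fun i =>
      ((hσ i).2.2.2 (hmem i) (hc i)).2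
    exact not_strictAnti_of_wellFoundedLT (fun i => G.attrRank R B (p i))
      (strictAnti_nat_of_succ_lt hlt)
  · rintro A ⟨_, hAR, σ, hσ, hreach⟩ v hv
    by_contra hvA
    have step : ∀ x : {x // x ∈ R ∧ x ∉ G.attr R B},
        ∃ y : {x // x ∈ R ∧ x ∉ G.attr R B}, σ x y := by
      rintro ⟨x, hx, hxa⟩
      by_cases hs : x ∈ G.steven
      · obtain ⟨u, hu⟩ := hσ.steven_move x hx hs
        obtain ⟨_, huR, hxu⟩ := hσ.sub x u hu
        exact ⟨⟨u, huR, not_mem_attr_of_edge hx hs hxa huR hxu⟩, hu⟩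
      · obtain ⟨u, huR, hxu, hua⟩ := exists_edge_not_mem_attr hx hs hxa
        exact ⟨⟨u, huR, hua⟩, hσ.audrey_move x hx hs u huR hxu⟩
    choose f hf using step
    obtain ⟨i, hi⟩ := hreach (fun n => (f^[n] ⟨v, hAR hv, hvA⟩ : {x // x ∈ R ∧ x ∉ G.attr R B}))
      hv fun i => by
        rw [Function.iterate_succ_apply']
        exact hf _
    exact (f^[i] ⟨v, hAR hv, hvA⟩).2.2 (subset_attr hi)

theorem IsStevenAttractor.exists_edge (h : G.IsStevenAttractor R B A) :
    ∀ v ∈ R, v ∈ G.steven → ∃ u ∈ R, G.edge v u := by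
  obtain ⟨_, _, σ, hσ, _⟩ := h.1
  intro v hv hs
  obtain ⟨u, hu⟩ := hσ.steven_move v hv hs
  exact ⟨u, (hσ.sub v u hu).2⟩

theorem IsStevenAttractor.subset (h : G.IsStevenAttractor R B A) : B ⊆ R :=
  h.1.1.trans h.1.2.1

theorem IsStevenAttractor.eq_attr [Finite V] (h : G.IsStevenAttractor R B A) :
    A = G.attr R B :=
  h.unique (isStevenAttractor_attr h.subset h.exists_edge)

/-- Outside an attractor no Steven move enters it, and Audrey always has a move that avoids it. -/
theorem IsSubgame.diff_attr [Finite V] (hR : G.IsSubgame R) : G.IsSubgame (R \ G.attr R B) := by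
  intro v hv
  by_cases hs : v ∈ G.steven
  · obtain ⟨u, huR, hvu⟩ := hR v hv.1
    exact ⟨u, ⟨huR, not_mem_attr_of_edge hv.1 hs hv.2 huR hvu⟩, hvu⟩
  · obtain ⟨u, huR, hvu, hua⟩ := exists_edge_not_mem_attr hv.1 hs hv.2
    exact ⟨u, ⟨huR, hua⟩, hvu⟩

theorem IsSubgame.isStevenAttractor_attr [Finite V] (hR : G.IsSubgame R) (hB : B ⊆ R) :
    G.IsStevenAttractor R B (G.attr R B) :=
  ParityGame.isStevenAttractor_attr hB fun v hv _ => hR v hv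

/-! ### From decompositions to progress measures -/

/-- A progress measure on `R \ attr R S` and a map `ν` on `S` combine into a progress measure on
`R` in which the first entry is `0` on `S`, the rank on `attr R S \ S`, and larger elsewhere. -/
theorem exists_measure_of_attr [Finite V] {h : ℕ} {S : Set V} (hSR : S ⊆ R)
    (hprio : ∀ v ∈ R, v ∉ S → G.priority v ≤ 2 * h + 1) {ν : V → Fin h → ℕ}
    (hS : ∀ v ∈ S,
      (v ∈ G.steven → ∃ u ∈ R, G.edge v u ∧ (G.priority v = 2 * (h + 1) ∨
        (u ∈ S ∧ G.priority v ≤ 2 * h ∧ G.Progressive ν v u))) ∧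
      (v ∉ G.steven → ∀ u ∈ R, G.edge v u → (G.priority v = 2 * (h + 1) ∨
        (u ∈ S ∧ G.priority v ≤ 2 * h ∧ G.Progressive ν v u))))
    {μ' : V → Fin (h + 1) → ℕ} (hμ' : G.IsStevenProgressMeasure (R \ G.attr R S) μ') :
    ∃ μ : V → Fin (h + 1) → ℕ, G.IsStevenProgressMeasure R μ ∧ ∀ k, 2 ≤ k →
      (heavyHeads R μ k).ncard ≤ (heavyHeads (R \ G.attr R S) μ' k).ncard +
        if k ≤ (measureTree S ν).strahler then 1 else 0 := by
  classical
  obtain ⟨N, hN⟩ := (Set.finite_range (G.attrRank R S)).bddAbove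
  replace hN : ∀ v, G.attrRank R S v ≤ N := fun v => hN ⟨v, rfl⟩
  -- The shift by `N + 1` lifts the rest above every rank, so Audrey's edges from there into the
  -- attractor are progressive.
  let μ : V → Fin (h + 1) → ℕ := fun v =>
    if v ∈ S then Fin.cons 0 (ν v)
    else if v ∈ G.attr R S then Fin.cons (G.attrRank R S v) 0
    else Fin.cons (N + 1 + μ' v 0) (Fin.tail (μ' v))
  have μS : ∀ v ∈ S, μ v = Fin.cons 0 (ν v) := fun v hv => if_pos hv
  have μA : ∀ v ∈ G.attr R S, v ∉ S → μ v = Fin.cons (G.attrRank R S v) 0 := fun v hv hvS => by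
    simp only [μ, if_neg hvS, if_pos hv]
  have μR : ∀ v, v ∉ G.attr R S → μ v = Fin.cons (N + 1 + μ' v 0) (Fin.tail (μ' v)) :=
    fun v hv => by
      have hvS : v ∉ S := fun h => hv (subset_attr h)
      simp only [μ, if_neg hvS, if_neg hv]
  have headA : ∀ v ∈ G.attr R S, μ v 0 = G.attrRank R S v := fun v hv => by
    by_cases hvS : v ∈ S
    · rw [μS v hvS, attrRank_eq_zero hvS]; rfl
    · rw [μA v hv hvS]; rfl
  have headR : ∀ v, v ∉ G.attr R S → μ v 0 = N + 1 + μ' v 0 := fun v hv => by rw [μR v hv]; rfl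
  -- The alternatives cover the two uses: `S` of top priority, where every edge is progressive, or
  -- `S` a trap measured by `ν`.
  have progS : ∀ v ∈ S, ∀ u, (G.priority v = 2 * (h + 1) ∨
      (u ∈ S ∧ G.priority v ≤ 2 * h ∧ G.Progressive ν v u)) → G.Progressive μ v u := by
    rintro v hv u (hp | ⟨hu, hp, hprog⟩)
    · exact G.progressive_of_priority_eq hp u
    · rw [progressive_iff_of_head_eq (by omega) (by rw [μS v hv, μS u hu]; rfl)]
      simpa only [Progressive, μS v hv, μS u hu, Fin.tail_cons] using hprog
  have progR : ∀ v ∈ R \ G.attr R S, ∀ u ∈ R \ G.attr R S, G.Progressive μ' v u →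
      G.Progressive μ v u := by
    intro v hv u hu hprog
    have hp := hprio v hv.1 fun h => hv.2 (subset_attr h)
    rcases (hprog.head_le hp).lt_or_eq with hlt | heq
    · refine progressive_of_head_lt hp ?_
      rw [headR v hv.2, headR u hu.2]
      omega
    · rw [progressive_iff_of_head_eq hp heq] at hprog
      rw [progressive_iff_of_head_eq hp (by rw [headR v hv.2, headR u hu.2, heq])]
      simpa only [Progressive, μR v hv.2, μR u hu.2, Fin.tail_cons] using hprog
  refine ⟨μ, fun v hv => ?_, fun k hk => ?_⟩
  · by_cases hvS : v ∈ S
    · refine ⟨fun hs => ?_, fun hs u hu hvu => progS v hvS u ((hS v hvS).2 hs u hu hvu)⟩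
      obtain ⟨u, hu, hvu, h'⟩ := (hS v hvS).1 hs
      exact ⟨u, hu, hvu, progS v hvS u h'⟩
    have hp := hprio v hv hvS
    by_cases hva : v ∈ G.attr R S
    · have hlt : ∀ u, u ∈ G.attr R S ∧ G.attrRank R S u < G.attrRank R S v →
          G.Progressive μ v u := fun u hu => progressive_of_head_lt hp (by
        rw [headA v hva, headA u hu.1]
        exact hu.2)
      rcases (attr_cases hva hvS).2 with ⟨hs, u, hu, hvu, hlow⟩ | ⟨hs, hall⟩
      · exact ⟨fun _ => ⟨u, hu, hvu, hlt u hlow⟩, fun h => absurd hs h⟩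
      · exact ⟨fun h => absurd h hs, fun _ u hu hvu => hlt u (hall u hu hvu)⟩
    · refine ⟨fun hs => ?_, fun hs u hu hvu => ?_⟩
      · obtain ⟨u, hu, hvu, hprog⟩ := (hμ' v ⟨hv, hva⟩).1 hs
        exact ⟨u, hu.1, hvu, progR v ⟨hv, hva⟩ u hu hprog⟩
      · by_cases hua : u ∈ G.attr R S
        · refine progressive_of_head_lt hp ?_
          rw [headR v hva, headA u hua]
          have := hN u
          omega
        · exact progR v ⟨hv, hva⟩ u ⟨hu, hua⟩ ((hμ' v ⟨hv, hva⟩).2 hs u ⟨hu, hua⟩ hvu)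
  -- Head 0 has fibre `S` and the tree of `ν`; heads from 1 to `N` carry only zero tails, hence
  -- paths; larger heads are the shifted heads of `μ'`.
  · have hsub : heavyHeads R μ k ⊆ (fun a => N + 1 + a) '' heavyHeads (R \ G.attr R S) μ' k ∪
        if k ≤ (measureTree S ν).strahler then {0} else ∅ := by
      intro a ha
      rw [heavyHeads, Set.mem_ofPred_eq] at ha
      rcases Nat.eq_zero_or_pos a with rfl | ha0
      · right
        have e : {v ∈ R | μ v 0 = 0} = S := by
          ext v
          refine ⟨fun hv => ?_, fun hv => ⟨hSR hv, by rw [μS v hv]; rfl⟩⟩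
          by_contra hvS
          have h0 := hv.2
          by_cases hva : v ∈ G.attr R S
          · rw [headA v hva] at h0
            exact (attrRank_pos hva hvS).ne' h0
          · rw [headR v hva] at h0
            omega
        rw [measureTree_congr e (ν := ν) fun v hv => by rw [μS v hv, Fin.tail_cons]] at ha
        rw [if_pos ha]
        rfl
      · left
        rcases Nat.lt_or_ge a (N + 1) with haN | haN
        · have hzero : ∀ v ∈ {v ∈ R | μ v 0 = a}, Fin.tail (μ v) = 0 := by
            rintro v ⟨hv, hva⟩
            have hvA : v ∈ G.attr R S := by
              by_contra hc
              rw [headR v hc] at hva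
              omega
            have hvS : v ∉ S := fun hc => by
              rw [headA v hvA, attrRank_eq_zero hc] at hva
              omega
            rw [μA v hvA hvS, Fin.tail_cons]
          rw [strahler_measureTree_of_subsingleton
            fun v hv u hu => by rw [hzero v hv, hzero u hu]] at ha
          omega
        · obtain ⟨b, rfl⟩ := Nat.exists_eq_add_of_le haN
          refine ⟨b, ?_, rfl⟩
          have e : {v ∈ R | μ v 0 = N + 1 + b} = {v ∈ R \ G.attr R S | μ' v 0 = b} := by
            ext v
            constructor
            · rintro ⟨hv, hvb⟩
              have hva : v ∉ G.attr R S := fun hc => by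
                rw [headA v hc] at hvb
                have := hN v
                omega
              rw [headR v hva] at hvb
              exact ⟨⟨hv, hva⟩, by omega⟩
            · rintro ⟨⟨hv, hva⟩, hvb⟩
              exact ⟨hv, by rw [headR v hva, hvb]⟩
          rwa [measureTree_congr e (ν := fun v => Fin.tail (μ' v))
            fun v hv => by rw [μR v hv.1.2, Fin.tail_cons]] at ha
    refine (Set.ncard_le_ncard hsub ?_).trans ((Set.ncard_union_le _ _).trans
      (add_le_add (Set.ncard_image_le (finite_heavyHeads hk)) ?_))
    · refine ((finite_heavyHeads hk).image _).union ?_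
      split_ifs <;> simp
    · split_ifs <;> simp

end ParityGame
namespace ParityGame

variable {V : Type u} {G : ParityGame V} {R : Set V}

/-- Each triple adds at most one heavy head, the one of `S_i`. The loss of 1 in `ih` is why
threshold `k + 1` for the measure is matched with threshold `k` for the decomposition. -/
theorem exists_measure_of_isLayering [Finite V] {h : ℕ}
    (ih : ∀ (S : Set V) (H : DecompositionData V h), (∀ v ∈ S, G.priority v ≤ 2 * h) →
      G.IsStevenDecomposition h S H → ∃ ν : V → Fin h → ℕ, G.IsStevenProgressMeasure S ν ∧
        (measureTree S ν).strahler ≤ (H.tree h).strahler + 1)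
    (L : List (Set V × DecompositionData V h × Set V)) :
    ∀ R : Set V, (∀ v ∈ R, G.priority v ≤ 2 * h + 1) →
      G.IsLayering h (G.IsStevenDecomposition h) R L →
      ∃ μ : V → Fin (h + 1) → ℕ, G.IsStevenProgressMeasure R μ ∧ ∀ k, 1 ≤ k →
        (heavyHeads R μ (k + 1)).ncard ≤ (L.map fun p => DecompositionData.tree h p.2.1).countP
          fun t => k ≤ t.strahler := by
  induction L with
  | nil =>
    rintro R - rfl
    refine ⟨0, fun v hv => absurd hv (Set.notMem_empty v), fun k hk => ?_⟩
    have := heavyHeads_subset (R := ∅) (μ := (0 : V → Fin (h + 1) → ℕ))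
      (show 2 ≤ k + 1 by omega)
    rw [Set.image_empty, Set.subset_empty_iff] at this
    simp [this]
  | cons p L ihL =>
    obtain ⟨S, H, A⟩ := p
    rintro R hR ⟨-, ⟨hSR, σ, hσ, htrap⟩, hS, hH, hA, hL⟩
    obtain ⟨ν, hν, hνk⟩ := ih S H hS hH
    obtain rfl := hA.eq_attr
    obtain ⟨μ', hμ', hμk⟩ := ihL _ (fun v hv => hR v hv.1) hL
    have hSν : ∀ v ∈ S, (v ∈ G.steven → ∃ u ∈ R, G.edge v u ∧
          (G.priority v = 2 * (h + 1) ∨ (u ∈ S ∧ G.priority v ≤ 2 * h ∧ G.Progressive ν v u))) ∧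
        (v ∉ G.steven → ∀ u ∈ R, G.edge v u →
          (G.priority v = 2 * (h + 1) ∨
            (u ∈ S ∧ G.priority v ≤ 2 * h ∧ G.Progressive ν v u))) := by
      refine fun v hv => ⟨fun hs => ?_, fun hs u hu hvu => Or.inr ?_⟩
      · obtain ⟨u, hu, hvu, hp⟩ := (hν v hv).1 hs
        exact ⟨u, hSR hu, hvu, Or.inr ⟨hu, hS v hv, hp⟩⟩
      · have huS : u ∈ S := htrap v hv u (hσ.audrey_move v (hSR hv) hs u hu hvu)
        exact ⟨huS, hS v hv, (hν v hv).2 hs u huS hvu⟩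
    obtain ⟨μ, hμ, hk⟩ := exists_measure_of_attr hSR (fun v hv _ => hR v hv) hSν hμ'
    refine ⟨μ, hμ, fun k hk1 => (hk (k + 1) (by omega)).trans ?_⟩
    rw [List.map_cons, List.countP_cons]
    refine add_le_add (hμk k hk1) ?_
    simp only [decide_eq_true_eq]
    split_ifs <;> omega

/-- Every attractor decomposition yields a progress measure whose tree has a Strahler number that
is larger by at most `1`. -/
theorem IsStevenDecomposition.exists_measure [Finite V] {h : ℕ} :
    ∀ {R : Set V} {H : DecompositionData V h}, (∀ v ∈ R, G.priority v ≤ 2 * h) →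
      G.IsStevenDecomposition h R H → ∃ μ : V → Fin h → ℕ, G.IsStevenProgressMeasure R μ ∧
        (measureTree R μ).strahler ≤ (H.tree h).strahler + 1 := by
  induction h with
  | zero =>
    rintro R H hR ⟨hA, -⟩
    have hprog : ∀ v ∈ R, ∀ u, G.Progressive (fun _ => Fin.elim0 : V → Fin 0 → ℕ) v u :=
      fun v hv u => G.progressive_of_priority_eq (Nat.le_zero.1 (hR v hv)) u
    refine ⟨fun _ => Fin.elim0, fun v hv => ⟨fun hs => ?_, fun _ u _ _ => hprog v hv u⟩, ?_⟩
    · obtain ⟨u, hu, hvu⟩ := hA.exists_edge v hv hs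
      exact ⟨u, hu, hvu, hprog v hv u⟩
    · rw [strahler_measureTree_of_subsingleton fun _ _ _ _ => rfl]
      omega
  | succ h ih =>
    rintro R ⟨A, L⟩ hR ⟨hA, hL⟩
    dsimp only at hA hL
    obtain rfl := hA.eq_attr
    have hprio : ∀ v ∈ R, v ∉ {v ∈ R | G.priority v = 2 * (h + 1)} →
        G.priority v ≤ 2 * h + 1 := fun v hv hvD => by
      have h₁ := hR v hv
      have h₂ : G.priority v ≠ 2 * (h + 1) := fun e => hvD ⟨hv, e⟩
      omega
    obtain ⟨μ', hμ', hμk⟩ := exists_measure_of_isLayering (fun S H hS hH => ih hS hH) L _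
      (fun v hv => hprio v hv.1 fun hvD => hv.2 (subset_attr hvD)) hL
    -- Truncation at priority `d` is empty, so the top-priority vertices can take the constant tail
    -- 0, which contributes only a path.
    obtain ⟨μ, hμ, hk⟩ := exists_measure_of_attr (Set.sep_subset _ _) hprio
      (ν := fun _ _ => 0) (fun v hv => ⟨fun hs => (hA.exists_edge v hv.1 hs).imp
        fun u hu => ⟨hu.1, hu.2, Or.inl hv.2⟩, fun _ _ _ _ => Or.inl hv.2⟩) hμ'
    refine ⟨μ, hμ, ?_⟩
    change _ ≤ (OrderedTree.node (L.map fun p => DecompositionData.tree h p.2.1)).strahler + 1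
    have h1 := OrderedTree.one_le_strahler (.node (L.map fun p => DecompositionData.tree h p.2.1))
    generalize hT :
      (OrderedTree.node (L.map fun p => DecompositionData.tree h p.2.1)).strahler = k at h1 ⊢
    have hT' := hT.le
    rw [OrderedTree.strahler_node_le_iff h1] at hT'
    rw [strahler_measureTree_of_subsingleton fun _ _ _ _ => rfl] at hk
    rw [strahler_measureTree_le_iff (by omega)]
    -- The two counts for the bound `k + 1` on the measure reduce to the two counts for the bound
    -- `k` on `T_H`.
    have k1 := hk (k + 1) (by omega)
    have k2 := hk (k + 1 + 1) (by omega)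
    rw [if_neg (by omega)] at k1 k2
    have m1 := hμk k h1
    have m2 := hμk (k + 1) (by omega)
    omega

/-! ### From progress measures to decompositions -/

section OfMeasure

variable {A : Type w} [LinearOrder A]

theorem IsStevenProgressMeasure.diff_attr [Finite V] {h : ℕ} {B : Set V} {μ : V → Fin h → A}
    (hμ : G.IsStevenProgressMeasure R μ) : G.IsStevenProgressMeasure (R \ G.attr R B) μ := by
  refine fun v hv => ⟨fun hs => ?_, fun hs u hu hvu => (hμ v hv.1).2 hs u hu.1 hvu⟩
  obtain ⟨u, hu, hvu, hp⟩ := (hμ v hv.1).1 hs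
  exact ⟨u, ⟨hu, not_mem_attr_of_edge hv.1 hs hv.2 hu hvu⟩, hvu, hp⟩

/-- The induction runs over a list of possible heads rather than those in use, since removing
attractors may exhaust a head. Such a head is skipped, which is why the trees match only a sublist.
-/
theorem exists_isLayering_of_measure [Finite V] {h : ℕ} {μ : V → Fin (h + 1) → A}
    {T : A → OrderedTree} {U : Set V}
    (ih : ∀ (S : Set V) (a : A), S ⊆ U → (∀ v ∈ S, G.priority v ≤ 2 * h) → G.IsSubgame S →
      (∀ v ∈ S, μ v 0 = a) → G.IsStevenProgressMeasure S (fun v => Fin.tail (μ v)) →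
      ∃ H : DecompositionData V h, G.IsStevenDecomposition h S H ∧ (H.tree h).Embeds (T a))
    (L : List A) (hL : L.Pairwise (· < ·)) :
    ∀ R ⊆ U, (∀ v ∈ R, G.priority v ≤ 2 * h + 1) → G.IsSubgame R →
      G.IsStevenProgressMeasure R μ → (∀ v ∈ R, μ v 0 ∈ L) →
      ∃ l : List (Set V × DecompositionData V h × Set V),
        G.IsLayering h (G.IsStevenDecomposition h) R l ∧
        List.SublistForall₂ OrderedTree.Embeds
          (l.map fun p => DecompositionData.tree h p.2.1) (L.map T) := by
  induction hL with
  | nil =>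
    intro R _ _ _ _ hmem
    refine ⟨[], Set.eq_empty_of_forall_notMem fun v hv => ?_, .nil⟩
    exact absurd (hmem v hv) List.not_mem_nil
  | @cons a L hlt hL ihL =>
    intro R hRU hR hsub hμ hmem
    have hle : ∀ v ∈ R, a ≤ μ v 0 := fun v hv => by
      rcases List.mem_cons.1 (hmem v hv) with h | h
      exacts [h.ge, (hlt _ h).le]
    by_cases hne : {v ∈ R | μ v 0 = a}.Nonempty
    swap
    · obtain ⟨l, hl, hl'⟩ := ihL R hRU hR hsub hμ fun v hv =>
        (List.mem_cons.1 (hmem v hv)).resolve_left fun e => hne ⟨v, hv, e⟩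
      exact ⟨l, hl, .cons_right hl'⟩
    set S := {v ∈ R | μ v 0 = a}
    have hSR : S ⊆ R := Set.sep_subset _ _
    have stay : ∀ v ∈ S, ∀ u ∈ R, G.Progressive μ v u → u ∈ S := fun v hv u hu hp =>
      ⟨hu, le_antisymm ((hp.head_le (hR v hv.1)).trans_eq hv.2) (hle u hu)⟩
    have hsubS : ∀ v ∈ S, ∃ u ∈ S, G.edge v u ∧ G.Progressive μ v u := by
      intro v hv
      by_cases hs : v ∈ G.steven
      · obtain ⟨u, hu, hvu, hp⟩ := (hμ v hv.1).1 hs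
        exact ⟨u, stay v hv u hu hp, hvu, hp⟩
      · obtain ⟨u, hu, hvu⟩ := hsub v hv.1
        have hp := (hμ v hv.1).2 hs u hu hvu
        exact ⟨u, stay v hv u hu hp, hvu, hp⟩
    have hSprio : ∀ v ∈ S, G.priority v ≤ 2 * h := fun v hv => by
      have h₁ := hR v hv.1
      by_contra hc
      obtain ⟨u, hu, -, hp⟩ := hsubS v hv
      -- A vertex of priority `d - 1` would need a successor with a smaller head, but `a` is the
      -- minimum.
      have h₂ := hp.head_lt (show G.priority v = 2 * h + 1 by omega)
      rw [hu.2, hv.2] at h₂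
      exact lt_irrefl _ h₂
    have hSprog : ∀ v ∈ S, ∀ u ∈ S, G.Progressive μ v u →
        G.Progressive (fun x => Fin.tail (μ x)) v u := fun v hv u hu hp =>
      (progressive_iff_of_head_eq (hR v hv.1) (hu.2.trans hv.2.symm)).1 hp
    obtain ⟨H, hH, hHT⟩ := ih S a (hSR.trans hRU) hSprio
      (fun v hv => (hsubS v hv).imp fun u hu => ⟨hu.1, hu.2.1⟩) (fun v hv => hv.2) (by
        refine fun v hv => ⟨fun _ => ?_, fun hs u hu hvu =>
          hSprog v hv u hu ((hμ v hv.1).2 hs u hu.1 hvu)⟩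
        obtain ⟨u, hu, hvu, hp⟩ := hsubS v hv
        exact ⟨u, hu, hvu, hSprog v hv u hu hp⟩)
    obtain ⟨l, hl, hl'⟩ := ihL (R \ G.attr R S) (Set.sdiff_subset.trans hRU)
      (fun v hv => hR v hv.1) hsub.diff_attr hμ.diff_attr fun v hv => (List.mem_cons.1 (hmem v hv.1)).resolve_left
        fun e => hv.2 (subset_attr ⟨hv.1, e⟩)
    refine ⟨(S, H, G.attr R S) :: l, ⟨hne, ⟨hSR, fun v u => v ∈ R ∧ u ∈ R ∧ G.edge v u ∧
      (v ∈ S → u ∈ S), ⟨fun v u hvu => ⟨hvu.1, hvu.2.1, hvu.2.2.1⟩, fun v hv _ => ?_,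
        fun v hv hs u hu hvu => ⟨hv, hu, hvu, fun hvS =>
          stay v hvS u hu ((hμ v hv).2 hs u hu hvu)⟩⟩, fun v hv u hvu => hvu.2.2.2 hv⟩,
      hSprio, hH, hsub.isStevenAttractor_attr hSR, hl⟩, .cons hHT hl'⟩
    by_cases hvS : v ∈ S
    · obtain ⟨u, hu, hvu, -⟩ := hsubS v hvS
      exact ⟨u, hv, hu.1, hvu, fun _ => hu⟩
    · obtain ⟨u, hu, hvu⟩ := hsub v hv
      exact ⟨u, hv, hu, hvu, fun h => absurd h hvS⟩

theorem exists_decomposition_zero [Finite V] (hR : ∀ v ∈ R, G.priority v = 0)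
    (hsub : G.IsSubgame R) :
    ∃ H : DecompositionData V 0, G.IsStevenDecomposition 0 R H ∧ H.tree 0 = .node [] := by
  have e : {v ∈ R | G.priority v = 0} = R := Set.sep_eq_self_iff_mem_true.2 hR
  refine ⟨G.attr R R, ⟨?_, Set.sdiff_eq_empty.2 subset_attr⟩, rfl⟩
  rw [e]
  exact hsub.isStevenAttractor_attr subset_rfl

/-- Every progress measure yields an attractor decomposition whose tree embeds in the tree of the
measure, and more generally in every tree generated by sequences that include its values. -/
theorem IsStevenProgressMeasure.exists_decomposition [Finite V] {h : ℕ} :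
    ∀ {R : Set V} {μ : V → Fin h → A} {X : Finset (Fin h → A)},
      (∀ v ∈ R, G.priority v ≤ 2 * h) → G.IsSubgame R → G.IsStevenProgressMeasure R μ →
      (∀ v ∈ R, μ v ∈ X) → ∃ H : DecompositionData V h, G.IsStevenDecomposition h R H ∧
        (H.tree h).Embeds (generatedTree h X) := by
  induction h with
  | zero =>
    intro R μ X hR hsub _ _
    obtain ⟨H, hH, hT⟩ := exists_decomposition_zero (fun v hv => Nat.le_zero.1 (hR v hv)) hsub
    refine ⟨H, hH, ?_⟩
    rw [hT, generatedTree]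
    exact OrderedTree.embeds_of_sublistForall₂ .nil
  | succ h ih =>
    intro R μ X hR hsub hμ hX
    set D := {v ∈ R | G.priority v = 2 * (h + 1)}
    have hDR : D ⊆ R := Set.sep_subset _ _
    have hprio : ∀ v ∈ R \ G.attr R D, G.priority v ≤ 2 * h + 1 := fun v hv => by
      have h₁ := hR v hv.1
      have h₂ : G.priority v ≠ 2 * (h + 1) := fun e => hv.2 (subset_attr ⟨hv.1, e⟩)
      omega
    -- The set `S` may hold only part of a fibre after attractors are removed, so the recursion
    -- compares it with the full fibre in `X`.
    obtain ⟨l, hl, hl'⟩ := exists_isLayering_of_measure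
      (μ := μ) (U := R) (T := fun a => generatedTree h ((X.filter fun m => m 0 = a).image Fin.tail))
      (fun S a hSR hS hsubS ha hμS => ih hS hsubS hμS fun v hv =>
        Finset.mem_image_of_mem _ (Finset.mem_filter.2 ⟨hX v (hSR hv), ha v hv⟩))
      ((X.image fun m => m 0).sort (· ≤ ·)) (Finset.sortedLT_sort _).pairwise
      (R \ G.attr R D) Set.sdiff_subset hprio hsub.diff_attr hμ.diff_attr
      (fun v hv => (Finset.mem_sort _).2 (Finset.mem_image_of_mem _ (hX v hv.1)))
    exact ⟨(G.attr R D, l), ⟨hsub.isStevenAttractor_attr hDR, hl⟩,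
      OrderedTree.embeds_of_sublistForall₂ hl'⟩

end OfMeasure

end ParityGame
namespace ParityGame

variable {V : Type u} {G : ParityGame V} {R : Set V}

/-! ### Decompositions of dominions -/

theorem _root_.Relation.TransGen.exists_path {α : Type u} {r : α → α → Prop} {a b : α}
    (h : Relation.TransGen r a b) :
    ∃ (n : ℕ) (c : ℕ → α), 0 < n ∧ c 0 = a ∧ c n = b ∧ ∀ i < n, r (c i) (c (i + 1)) := by
  induction h using Relation.TransGen.head_induction_on with
  | @single a hab =>
    refine ⟨1, fun i => if i = 0 then a else b, one_pos, rfl, rfl, fun i hi => ?_⟩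
    obtain rfl : i = 0 := by omega
    exact hab
  | @head a a' haa' _ ih =>
    obtain ⟨n, c, -, h0, hn, hc⟩ := ih
    refine ⟨n + 1, fun i => Nat.casesOn i a c, n.succ_pos, rfl, hn, fun i hi => ?_⟩
    cases i with
    | zero =>
      change r a (c 0)
      rwa [h0]
    | succ i => exact hc i (by omega)

/-- If all cycles of a strategy are even and the highest priority is odd, then some non-empty set
that is closed under the strategy avoids the highest priority. -/
theorem exists_closed_of_cyclesEven [Finite V] {σ : V → V → Prop} {p : ℕ}
    (hR : ∀ v ∈ R, G.priority v ≤ 2 * p + 1) (hne : R.Nonempty)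
    (hσR : ∀ v u, σ v u → v ∈ R ∧ u ∈ R) (htotal : ∀ v ∈ R, ∃ u, σ v u)
    (heven : G.CyclesEven σ R) :
    ∃ S ⊆ R, S.Nonempty ∧ (∀ v ∈ S, G.priority v ≤ 2 * p) ∧ TrapsAudrey σ S := by
  -- A cycle through such a vertex would have the odd maximum `2 * p + 1`.
  have hirr : ∀ v ∈ R, G.priority v = 2 * p + 1 → ¬ Relation.TransGen σ v v := by
    intro v hv hpv hvv
    obtain ⟨n, c, hn, h0, hcn, hc⟩ := hvv.exists_path
    have hmem : ∀ i ≤ n, c i ∈ R := fun i hi => by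
      rcases hi.lt_or_eq with hi | rfl
      · exact (hσR _ _ (hc i hi)).1
      · rwa [hcn]
    have hE := heven n c hn (hcn.trans h0.symm) hmem hc
    have hsup : ((Finset.range n).sup fun i => G.priority (c i)) = 2 * p + 1 := by
      refine le_antisymm (Finset.sup_le fun i hi => hR _ (hmem i (Finset.mem_range.1 hi).le)) ?_
      have := Finset.le_sup (f := fun i => G.priority (c i)) (Finset.mem_range.2 hn)
      rwa [h0, hpv] at this
    rw [hsup] at hE
    exact Nat.not_even_bit1 p hE
  have trap : ∀ S ⊆ R, S = {v ∈ R | ∀ u, Relation.ReflTransGen σ v u →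
      G.priority u ≤ 2 * p} → S.Nonempty →
      ∃ S ⊆ R, S.Nonempty ∧ (∀ v ∈ S, G.priority v ≤ 2 * p) ∧ TrapsAudrey σ S := by
    rintro S hSR rfl hS
    exact ⟨_, hSR, hS, fun v hv => hv.2 v .refl, fun v hv u hvu =>
      ⟨(hσR v u hvu).2, fun x hx => hv.2 x (.head hvu hx)⟩⟩
  refine trap _ (Set.sep_subset _ _) rfl ?_
  have mem_of : ∀ v ∈ R, ∀ u, Relation.ReflTransGen σ v u → u ∈ R := fun v hv u hvu => by
    induction hvu with
    | refl => exact hv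
    | tail _ h _ => exact (hσR _ _ h).2
  by_cases hodd : ∃ v ∈ R, G.priority v = 2 * p + 1
  · let r : {v // v ∈ R ∧ G.priority v = 2 * p + 1} → {v // v ∈ R ∧ G.priority v = 2 * p + 1} →
      Prop := fun u v => Relation.TransGen σ v u
    have hwf : WellFounded r :=
      @Finite.wellFounded_of_trans_of_irrefl _ _ r ⟨fun a b c hab hbc => hbc.trans hab⟩
        ⟨fun a => hirr a a.2.1 a.2.2⟩
    obtain ⟨v, hv, hpv⟩ := hodd
    -- From `m` no vertex of the odd top priority is reachable in one or more steps, so from its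
    -- successor `u` none is reachable at all.
    obtain ⟨m, -, hm⟩ := hwf.has_min Set.univ ⟨⟨v, hv, hpv⟩, trivial⟩
    obtain ⟨u, hu⟩ := htotal m m.2.1
    have huR := (hσR _ _ hu).2
    refine ⟨u, huR, fun x hx => ?_⟩
    have hxR := mem_of u huR x hx
    have := hR x hxR
    by_contra hc
    exact hm ⟨x, hxR, by omega⟩ trivial (Relation.TransGen.head' hu hx)
  · push Not at hodd
    obtain ⟨v, hv⟩ := hne
    refine ⟨v, hv, fun x hx => ?_⟩
    have hxR := mem_of v hv x hx
    have h₁ := hR x hxR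
    have h₂ := hodd x hxR
    omega

theorem CyclesEven.mono {σ τ : V → V → Prop} {D E : Set V} (h : G.CyclesEven σ D)
    (hστ : ∀ v u, τ v u → σ v u) (hED : E ⊆ D) : G.CyclesEven τ E :=
  fun n c hn hc hD hτ => h n c hn hc (fun i hi => hED (hD i hi)) fun i hi => hστ _ _ (hτ i hi)

/-- The restriction of a strategy to a set that Steven's moves cannot leave. -/
theorem IsStevenStrategy.restrict {σ : V → V → Prop} {S : Set V} (hσ : G.IsStevenStrategy R σ)
    (hSR : S ⊆ R) (hS : ∀ v ∈ S, v ∈ G.steven → ∀ u, σ v u → u ∈ S) :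
    G.IsStevenStrategy S fun v u => v ∈ S ∧ u ∈ S ∧ σ v u where
  sub v u h := ⟨h.1, h.2.1, (hσ.sub v u h.2.2).2.2⟩
  steven_move v hv hs := (hσ.steven_move v (hSR hv) hs).imp fun u hu => ⟨hv, hS v hv hs u hu, hu⟩
  audrey_move v hv hs u hu hvu := ⟨hv, hu, hσ.audrey_move v (hSR hv) hs u (hSR hu) hvu⟩

theorem IsStevenStrategy.exists_move {σ : V → V → Prop} (hσ : G.IsStevenStrategy R σ)
    (hsub : G.IsSubgame R) : ∀ v ∈ R, ∃ u, σ v u := by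
  intro v hv
  by_cases hs : v ∈ G.steven
  · exact hσ.steven_move v hv hs
  · obtain ⟨u, hu, hvu⟩ := hsub v hv
    exact ⟨u, hσ.audrey_move v hv hs u hu hvu⟩

theorem IsStevenStrategy.restrict_diff_attr {σ : V → V → Prop} {B : Set V}
    (hσ : G.IsStevenStrategy R σ) : G.IsStevenStrategy (R \ G.attr R B)
      fun v u => v ∈ R \ G.attr R B ∧ u ∈ R \ G.attr R B ∧ σ v u :=
  hσ.restrict Set.sdiff_subset fun v hv hs u hu =>
    ⟨(hσ.sub v u hu).2.1, not_mem_attr_of_edge hv.1 hs hv.2 (hσ.sub v u hu).2.1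
      (hσ.sub v u hu).2.2⟩

/-- A closed set without the odd top priority is a trap of lower level; removing its attractor
leaves a strictly smaller subgame, on which the strategy still has moves and even cycles. -/
theorem exists_isLayering_of_cyclesEven [Finite V] {h : ℕ}
    (ih : ∀ (S : Set V) (σ : V → V → Prop), (∀ v ∈ S, G.priority v ≤ 2 * h) → G.IsSubgame S →
      G.IsStevenStrategy S σ → G.CyclesEven σ S →
      ∃ H : DecompositionData V h, G.IsStevenDecomposition h S H)
    (R : Set V) : ∀ σ : V → V → Prop, (∀ v ∈ R, G.priority v ≤ 2 * h + 1) → G.IsSubgame R →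
      G.IsStevenStrategy R σ → G.CyclesEven σ R →
      ∃ l : List (Set V × DecompositionData V h × Set V),
        G.IsLayering h (G.IsStevenDecomposition h) R l := by
  induction R using WellFoundedLT.induction with
  | ind R ihR =>
    intro σ hR hsub hσ heven
    rcases R.eq_empty_or_nonempty with hne | hne
    · exact ⟨[], hne⟩
    have hmove := hσ.exists_move hsub
    obtain ⟨S, hSR, hS, hSprio, htrap⟩ := exists_closed_of_cyclesEven hR hne
      (fun v u h => ⟨(hσ.sub v u h).1, (hσ.sub v u h).2.1⟩) hmove heven
    obtain ⟨H, hH⟩ := ih S _ hSprio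
      (fun v hv => (hmove v (hSR hv)).imp fun u hu => ⟨htrap v hv u hu, (hσ.sub v u hu).2.2⟩)
      (hσ.restrict hSR fun v hv _ => htrap v hv) (heven.mono (fun _ _ h => h.2.2) hSR)
    obtain ⟨l, hl⟩ := ihR (R \ G.attr R S) (Set.sdiff_ssubset_left_iff.2 (by
        obtain ⟨v, hv⟩ := hS
        exact ⟨v, hSR hv, subset_attr hv⟩)) _
      (fun v hv => hR v hv.1) hsub.diff_attr hσ.restrict_diff_attr
      (heven.mono (fun _ _ h => h.2.2) Set.sdiff_subset)
    exact ⟨(S, H, G.attr R S) :: l, hS, ⟨hSR, σ, hσ, htrap⟩, hSprio, hH,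
      hsub.isStevenAttractor_attr hSR, hl⟩

theorem IsStevenStrategy.exists_decomposition [Finite V] {h : ℕ} :
    ∀ {R : Set V} {σ : V → V → Prop}, (∀ v ∈ R, G.priority v ≤ 2 * h) → G.IsSubgame R →
      G.IsStevenStrategy R σ → G.CyclesEven σ R →
      ∃ H : DecompositionData V h, G.IsStevenDecomposition h R H := by
  induction h with
  | zero =>
    intro R σ hR hsub _ _
    obtain ⟨H, hH, -⟩ := exists_decomposition_zero (fun v hv => Nat.le_zero.1 (hR v hv)) hsub
    exact ⟨H, hH⟩
  | succ h ih =>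
    intro R σ hR hsub hσ heven
    have hprio : ∀ v ∈ R \ G.attr R {v ∈ R | G.priority v = 2 * (h + 1)},
        G.priority v ≤ 2 * h + 1 := fun v hv => by
      have h₁ := hR v hv.1
      have h₂ : G.priority v ≠ 2 * (h + 1) := fun e => hv.2 (subset_attr ⟨hv.1, e⟩)
      omega
    obtain ⟨l, hl⟩ := exists_isLayering_of_cyclesEven (fun S σ h₁ h₂ h₃ h₄ => ih h₁ h₂ h₃ h₄)
      _ _ hprio hsub.diff_attr hσ.restrict_diff_attr
      (heven.mono (fun _ _ h => h.2.2) Set.sdiff_subset)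
    exact ⟨(_, l), hsub.isStevenAttractor_attr (Set.sep_subset _ _), hl⟩

/-- The union of all Steven dominions is a Steven dominion. -/
theorem isStevenDominion_largestStevenDominion [Finite V] :
    G.IsStevenDominion G.largestStevenDominion := by
  classical
  obtain ⟨n, e⟩ : ∃ n : ℕ, Nonempty ({D : Set V | G.IsStevenDominion D} ≃ Fin n) :=
    Finite.exists_equiv_fin _
  obtain ⟨e⟩ := e
  choose τ hτ htrap heven using fun D : {D : Set V | G.IsStevenDominion D} => D.2
  -- The dominions are numbered, and at `v` Steven follows the strategy of the first dominion that
  -- contains `v`.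
  let idx : V → ℕ := fun v => sInf {i | ∃ D : {D : Set V | G.IsStevenDominion D},
    v ∈ (D : Set V) ∧ (e D : ℕ) = i}
  have idx_spec : ∀ v ∈ G.largestStevenDominion,
      ∃ D : {D : Set V | G.IsStevenDominion D}, v ∈ (D : Set V) ∧ (e D : ℕ) = idx v := by
    rintro v ⟨D, hD, hv⟩
    exact Nat.sInf_mem (s := {i | ∃ D : {D : Set V | G.IsStevenDominion D},
    v ∈ (D : Set V) ∧ (e D : ℕ) = i})
      ⟨_, ⟨D, hD⟩, hv, rfl⟩
  let σ : V → V → Prop := fun v u => G.edge v u ∧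
    ∀ D : {D : Set V | G.IsStevenDominion D}, v ∈ (D : Set V) → (e D : ℕ) = idx v → τ D v u
  have step : ∀ v ∈ G.largestStevenDominion, ∀ u, σ v u →
      ∃ D : {D : Set V | G.IsStevenDominion D}, (e D : ℕ) = idx v ∧ v ∈ (D : Set V) ∧
        τ D v u ∧ u ∈ (D : Set V) ∧ idx u ≤ idx v := by
    intro v hv u hvu
    obtain ⟨D, hvD, hD⟩ := idx_spec v hv
    have h₁ := hvu.2 D hvD hD
    have h₂ := htrap D v hvD u h₁
    exact ⟨D, hD, hvD, h₁, h₂, hD ▸ Nat.sInf_le ⟨D, h₂, rfl⟩⟩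
  refine ⟨σ, ⟨fun v u h => ⟨trivial, trivial, h.1⟩, fun v _ hs => ?_, fun v _ hs u _ hvu =>
    ⟨hvu, fun D _ _ => (hτ D).audrey_move v trivial hs u trivial hvu⟩⟩, fun v hv u hvu => ?_, ?_⟩
  · by_cases hv : v ∈ G.largestStevenDominion
    · obtain ⟨D, hvD, hD⟩ := idx_spec v hv
      obtain ⟨u, hu⟩ := (hτ D).steven_move v trivial hs
      refine ⟨u, ((hτ D).sub v u hu).2.2, fun D' _ hD' => ?_⟩
      obtain rfl : D = D' := e.injective (Fin.ext (hD.trans hD'.symm))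
      exact hu
    · obtain ⟨u, hu⟩ := G.total v
      exact ⟨u, hu, fun D hD _ => absurd ⟨D, D.2, hD⟩ hv⟩
  · obtain ⟨D, -, -, -, hu, -⟩ := step v hv u hvu
    exact ⟨D, D.2, hu⟩
  · intro n c hn hcyc hmem hc
    -- The play stays in the current dominion, so the index never grows. On a cycle it is therefore
    -- constant, and the cycle belongs to a single dominion's strategy.
    have hanti : ∀ i ≤ n, ∀ j ≤ i, idx (c i) ≤ idx (c j) := by
      intro i hi j hj
      induction i, hj using Nat.le_induction with
      | base => exact le_rfl
      | succ i hji ih =>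
        obtain ⟨_, -, -, -, -, h⟩ := step _ (hmem i (by omega)) _ (hc i (by omega))
        exact h.trans (ih (by omega))
    have hconst : ∀ i ≤ n, idx (c i) = idx (c 0) := fun i hi =>
      le_antisymm (hanti i hi 0 i.zero_le) (hcyc ▸ hanti n le_rfl i hi)
    obtain ⟨D, h0, hD⟩ := idx_spec (c 0) (hmem 0 n.zero_le)
    have inD : ∀ i < n, c i ∈ (D : Set V) ∧ τ D (c i) (c (i + 1)) := by
      intro i hi
      obtain ⟨D', hD', hv, hτ', -, -⟩ := step _ (hmem i hi.le) _ (hc i hi)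
      obtain rfl : D = D' := e.injective (Fin.ext (by rw [hD, hD', hconst i hi.le]))
      exact ⟨hv, hτ'⟩
    refine heven D n c hn hcyc (fun i hi => ?_) fun i hi => (inD i hi).2
    rcases hi.lt_or_eq with hi | rfl
    · exact (inD i hi).1
    · rwa [hcyc]

theorem isSubgame_largestStevenDominion [Finite V] : G.IsSubgame G.largestStevenDominion := by
  obtain ⟨σ, hσ, htrap, -⟩ := G.isStevenDominion_largestStevenDominion
  intro v hv
  obtain ⟨u, hu⟩ := hσ.exists_move (fun v _ => (G.total v).imp fun u hu => ⟨trivial, hu⟩) v trivial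
  exact ⟨u, htrap v hv u hu, (hσ.sub v u hu).2.2⟩

theorem exists_decomposition_largestStevenDominion [Finite V] {h : ℕ}
    (hd : ∀ v, G.priority v ≤ 2 * h) :
    ∃ H : DecompositionData V h, G.IsStevenDecomposition h G.largestStevenDominion H := by
  obtain ⟨σ, hσ, htrap, heven⟩ := G.isStevenDominion_largestStevenDominion
  exact (hσ.restrict (Set.subset_univ _) fun v hv _ => htrap v hv).exists_decomposition
    (fun v _ => hd v) isSubgame_largestStevenDominion (heven.mono (fun _ _ h => h.2.2) subset_rfl)

end ParityGame
/-- Let `G` be a finite parity game with all priorities at most the even number `d = 2 * h`.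
The Steven Strahler number and the Steven progress-measure Strahler number of `G` are both attained,
and they differ by at most `1`.  Moreover, on every subgame `G ∩ R`, every Steven attractor
decomposition can be translated into a progress measure whose tree has a Strahler number larger by
at most `1`, and every progress measure into a Steven attractor decomposition whose tree can be
embedded in the tree of the measure (so that its Strahler number is no larger). -/
theorem mainTheorem4 {V : Type u} [Finite V] (G : ParityGame V) (h : ℕ)
    (hd : ∀ v, G.priority v ≤ 2 * h) :
    ((G.decompositionStrahlerNumbers h G.largestStevenDominion).Nonempty ∧
      (G.measureStrahlerNumbers h G.largestStevenDominion).Nonempty ∧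
      G.stevenMeasureStrahlerNumber h ≤ G.stevenStrahlerNumber h + 1 ∧
      G.stevenStrahlerNumber h ≤ G.stevenMeasureStrahlerNumber h + 1) ∧
    (∀ R : Set V, G.IsSubgame R →
      (∀ H : DecompositionData V h, G.IsStevenDecomposition h R H →
        ∃ μ : V → Fin h → ℕ, G.IsStevenProgressMeasure R μ ∧
          (ParityGame.measureTree R μ).strahler ≤ (H.tree h).strahler + 1) ∧
      (∀ (A : Type w) [LinearOrder A] [WellFoundedLT A] (μ : V → Fin h → A),
        G.IsStevenProgressMeasure R μ →
        ∃ H : DecompositionData V h, G.IsStevenDecomposition h R H ∧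
          (H.tree h).Embeds (ParityGame.measureTree R μ) ∧
          (H.tree h).strahler ≤ (ParityGame.measureTree R μ).strahler)) := by
  have toMeasure : ∀ R : Set V, ∀ H : DecompositionData V h, G.IsStevenDecomposition h R H →
      ∃ μ : V → Fin h → ℕ, G.IsStevenProgressMeasure R μ ∧
        (ParityGame.measureTree R μ).strahler ≤ (H.tree h).strahler + 1 :=
    fun R H hH => hH.exists_measure fun v _ => hd v
  refine ⟨?_, fun R hR => ⟨toMeasure R, fun A _ _ μ hμ => ?_⟩⟩
  · obtain ⟨H₀, hH₀⟩ := ParityGame.exists_decomposition_largestStevenDominion hd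
    obtain ⟨μ₀, hμ₀, -⟩ := toMeasure _ H₀ hH₀
    have hdec : (G.decompositionStrahlerNumbers h G.largestStevenDominion).Nonempty :=
      ⟨_, H₀, hH₀, rfl⟩
    have hmeas : (G.measureStrahlerNumbers h G.largestStevenDominion).Nonempty :=
      ⟨_, ℕ, inferInstance, inferInstance, μ₀, hμ₀, rfl⟩
    refine ⟨hdec, hmeas, ?_, ?_⟩
    · obtain ⟨H, hH, hk⟩ := Nat.sInf_mem hdec
      obtain ⟨μ, hμ, hle⟩ := toMeasure _ H hH
      rw [hk] at hle
      exact (Nat.sInf_le (s := G.measureStrahlerNumbers h G.largestStevenDominion)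
        ⟨ℕ, inferInstance, inferInstance, μ, hμ, rfl⟩).trans hle
    · obtain ⟨A, _, _, μ, hμ, hk⟩ := Nat.sInf_mem hmeas
      obtain ⟨H, hH, hT⟩ := ParityGame.IsStevenProgressMeasure.exists_decomposition
        (fun v _ => hd v) ParityGame.isSubgame_largestStevenDominion hμ (X := (Set.toFinite (μ '' G.largestStevenDominion)).toFinset)
        fun v hv => (Set.Finite.mem_toFinset _).2 (Set.mem_image_of_mem μ hv)
      -- This direction loses nothing: the Steven Strahler number is at most the progress-measure
      -- one.
      have hle : (H.tree h).strahler ≤ G.stevenMeasureStrahlerNumber h :=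
        hT.strahler_le.trans_eq hk
      exact (Nat.sInf_le (s := G.decompositionStrahlerNumbers h G.largestStevenDominion)
        ⟨H, hH, rfl⟩).trans (hle.trans (Nat.le_succ _))
  · obtain ⟨H, hH, hT⟩ := ParityGame.IsStevenProgressMeasure.exists_decomposition
      (fun v _ => hd v) hR hμ (X := (Set.toFinite (μ '' R)).toFinset)
      fun v hv => (Set.Finite.mem_toFinset _).2 (Set.mem_image_of_mem μ hv)
    exact ⟨H, hH, hT, hT.strahler_le⟩
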